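/- Let $\mathbb{K}$ be a field, $S=\mathbb{K}[x_1,\dots,x_n]$ and $\mathfrak m=(x_1,\dots,x_n)$. For a $\mathbb{Z}^n$-graded $S$-module $M$, a homogeneous element $u\in M$ and a set $Z\subseteq\{x_1,\dots,x_n\}$, the $\mathbb{K}$-subspace $u\mathbb{K}[Z]=\{uv : v\in\mathbb{K}[Z]\}$ of $M$ is called a Stanley space of dimension $|Z|$ if it is a nonzero free $\mathbb{K}[Z]$-module. A Stanley decomposition $\mathcal D$ of $M$ is a decomposition of $M$, as a $\mathbb{K}$-vector space, into a finite direct sum of Stanley spaces; $\mathrm{sdepth}(\mathcal D)$ is the minimum dimension of a Stanley space in $\mathcal D$, and, for finitely generated $M\neq 0$, the Stanley depth $\mathrm{sdepth}(M)$ is the maximum of $\mathrm{sdepth}(\mathcal D)$ over all Stanley decompositions $\mathcal D$ of $M$. The analytic spread $\ell(I)$ of an ideal $I\subseteq S$ is the Krull dimension of the fibre ring $\mathcal R(I)/\mathfrak m\mathcal R(I)$, where $\mathcal R(I)=\bigoplus_{k\ge 0}I^kt^k$ is the Rees algebra of $I$. Let $I$ be an ideal of $S$ that is generated by squarefree monomials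 and is generated in a single degree, with $S$, $I$ and $S/I$ carrying the standard $\mathbb{Z}^n$-grading in which $x_i$ has the $i$-th unit vector as its degree. Then $\ell(I)$ is finite and 1. if $I\neq 0$, then $\mathrm{sdepth}(I)\ge n-\ell(I)+1$; 2. if $I\neq S$, then $\mathrm{sdepth}(S/I)\ge n-\ell(I)$. -/

import Mathlib

open MvPolynomial

noncomputable section

namespace SquarefreeStanley

variable {K : Type*} [Field K] {n : ℕ}

/-! ### Stanley depth of multigraded modules -/

section StanleyDepth

variable {M : Type*} [AddCommGroup M] [Module K M] [Module (MvPolynomial (Fin n) K) M]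
  [IsScalarTower K (MvPolynomial (Fin n) K) M]

/-- The `K`-subspace `u K[Z]` of `M`, consisting of all `v • u` with `v ∈ K[Z]`, where `K[Z]` is
the subalgebra of polynomials in the variables belonging to `Z`. -/
def stanleySpace (u : M) (Z : Finset (Fin n)) : Submodule K M :=
  (Subalgebra.toSubmodule (supported K (Z : Set (Fin n)))).map
    ((LinearMap.toSpanSingleton (MvPolynomial (Fin n) K) M u).restrictScalars K)

/-- A Stanley decomposition of `M` with respect to a `ℤⁿ`-grading `𝓜` of `M`: finitely many
homogeneous elements `u i` and sets of variables `Z i` such that each `u i K[Z i]` is a (nonzero)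
free `K[Z i]`-module, with basis `u i`, and `M` is the direct sum of the subspaces `u i K[Z i]`. -/
structure StanleyDecomposition (𝓜 : (Fin n → ℤ) → Submodule K M) where
  /-- the number of Stanley spaces -/
  m : ℕ
  /-- the homogeneous generators -/
  u : Fin m → M
  /-- the sets of variables -/
  Z : Fin m → Finset (Fin n)
  homogeneous : ∀ i, ∃ a, u i ∈ 𝓜 a
  free : ∀ i, ∀ v ∈ supported K (Z i : Set (Fin n)), v • u i = 0 → v = 0
  isInternal : DirectSum.IsInternal fun i => stanleySpace (K := K) (u i) (Z i)

/-- The Stanley depth of a Stanley decomposition: the least dimension `|Z i|` of its Stanley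
spaces (`⊤` for the empty decomposition, which only the zero module has). -/
def StanleyDecomposition.sdepth {𝓜 : (Fin n → ℤ) → Submodule K M}
    (D : StanleyDecomposition 𝓜) : ℕ∞ :=
  ⨅ i, ((D.Z i).card : ℕ∞)

/-- The Stanley depth of a `ℤⁿ`-graded module: the largest Stanley depth of a Stanley
decomposition. For `M ≠ 0` all the values are at most `n`, so that the supremum is a maximum. -/
def sdepth (𝓜 : (Fin n → ℤ) → Submodule K M) : ℕ∞ :=
  ⨆ D : StanleyDecomposition 𝓜, D.sdepth

end StanleyDepth

/-! ### The multigraded modules `S`, `I` and `S ⧸ I` -/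

/-- The standard `ℤⁿ`-grading of `S = K[x₁, …, xₙ]`, for which `xᵢ` has the `i`-th unit vector as
its degree. -/
def fineGrading (K : Type*) [Field K] (n : ℕ) (a : Fin n → ℤ) :
    Submodule K (MvPolynomial (Fin n) K) :=
  weightedHomogeneousSubmodule K (fun i : Fin n => (Pi.single i 1 : Fin n → ℤ)) a

/-- The `ℤⁿ`-grading of a monomial ideal `I` induced from that of `S`. -/
def idealGrading (I : Ideal (MvPolynomial (Fin n) K)) (a : Fin n → ℤ) : Submodule K I :=
  (fineGrading K n a).comap ((Submodule.subtype I).restrictScalars K)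

/-- The `ℤⁿ`-grading of `S ⧸ I`, for a monomial ideal `I`, induced from that of `S`. -/
def quotientGrading (I : Ideal (MvPolynomial (Fin n) K)) (a : Fin n → ℤ) :
    Submodule K (MvPolynomial (Fin n) K ⧸ I) :=
  (fineGrading K n a).map ((Submodule.mkQ I).restrictScalars K)

/-! ### Ideals -/

/-- `I` is generated by squarefree monomials. -/
def IsSquarefreeMonomialIdeal (I : Ideal (MvPolynomial (Fin n) K)) : Prop :=
  ∃ A : Set (Fin n →₀ ℕ), (∀ a ∈ A, ∀ i, a i ≤ 1) ∧
    I = Ideal.span ((fun a => monomial a (1 : K)) '' A)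

/-- For some `d`, the ideal `I` is generated by homogeneous polynomials of degree `d`. For a
monomial ideal this says that all its minimal monomial generators have the same degree. -/
def IsGeneratedInSingleDegree (I : Ideal (MvPolynomial (Fin n) K)) : Prop :=
  ∃ d : ℕ, I = Ideal.span {f | f ∈ I ∧ f.IsHomogeneous d}

/-- The graded maximal ideal `𝔪 = (x₁, …, xₙ)`. -/
def gradedMaximalIdeal (K : Type*) [Field K] (n : ℕ) : Ideal (MvPolynomial (Fin n) K) :=
  Ideal.span (Set.range X)

/-- The fibre ring `𝓡(I) / 𝔪 𝓡(I)`, where `𝓡(I)` is the Rees algebra of `I`. -/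
abbrev FibreRing (I : Ideal (MvPolynomial (Fin n) K)) : Type _ :=
  reesAlgebra I ⧸ (gradedMaximalIdeal K n).map
    (algebraMap (MvPolynomial (Fin n) K) (reesAlgebra I))

/-- The analytic spread `ℓ(I)`: the Krull dimension of the fibre ring. -/
def analyticSpread (I : Ideal (MvPolynomial (Fin n) K)) : WithBot ℕ∞ :=
  ringKrullDim (FibreRing I)

end SquarefreeStanley

end

/-!
Let `U` be the set of exponents of the generators of `I`, all squarefree and of degree `d`, and let
`extRank U` be the rank of the exponent vectors `(a, 1)` of the monomials `x^a t` with `a ∈ U`.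
The theorem follows from two facts.

* `extRank U ≤ ℓ(I)` (`natCast_le_analyticSpread`). The elements `x^a t` for linearly independent
  vectors `(a, 1)` remain algebraically independent in the fibre ring. Indeed the coefficient of
  `t^k` in a polynomial in these elements is homogeneous of degree `d k`, whereas in an element of
  `𝔪 𝓡(I)` all of its terms have degree larger than `d k`. A finitely generated algebra over a field
  with `r` algebraically independent elements has dimension at least `r`, by Noether normalization
  and going up.

* The monomials in `I` are a disjoint union of cones of dimension at least `n + 1 - extRank U`, and
  those outside `I` of cones of dimension at least `n - extRank U` (`hasConePartition_multiples`,
  `hasConePartition_nonmultiples`). This holds for every set `U` of squarefree exponents, and is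
  proved by induction on the number of variables. If `x` occurs in `U`, the monomials without `x`
  are governed by the elements of `U` without `x`, whose rank is smaller, and those divisible by `x`
  by the elements of `U` with `x` set to `1`, whose rank is not larger; in the second case `x`
  becomes a free variable of every cone. A single degree of the generators is not preserved by
  setting `x` to `1`, which is why the induction does without it.

The monomials in `I`, and the residue classes of those outside `I`, are homogeneous bases of `I` and
`S ⧸ I`, so that cone partitions give Stanley decompositions (`le_sdepth_of_hasConePartition`).
-/

namespace SquarefreeStanley

/-! ### Partitions of sets of monomials into Stanley cones -/

section Cones

variable {σ : Type*}

/-- The exponents of the monomials in the Stanley space `x^u K[Z]`. -/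
def cone (u : σ →₀ ℕ) (Z : Finset σ) : Set (σ →₀ ℕ) :=
  {a | u ≤ a ∧ ∀ i ∉ Z, a i = u i}

/-- The set `P` of exponents is a finite disjoint union of cones whose sets of free variables have
at least `k` elements. -/
def HasConePartition (k : ℕ) (P : Set (σ →₀ ℕ)) : Prop :=
  ∃ (m : ℕ) (u : Fin m → σ →₀ ℕ) (Z : Fin m → Finset σ), (∀ i, k ≤ (Z i).card) ∧
    Pairwise (fun i j => Disjoint (cone (u i) (Z i)) (cone (u j) (Z j))) ∧
    ⋃ i, cone (u i) (Z i) = P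

lemma self_mem_cone (u : σ →₀ ℕ) (Z : Finset σ) : u ∈ cone u Z :=
  ⟨le_rfl, fun _ _ => rfl⟩

lemma mem_cone_iff_exists {u a : σ →₀ ℕ} {Z : Finset σ} :
    a ∈ cone u Z ↔ ∃ c : σ →₀ ℕ, (c.support : Set σ) ⊆ Z ∧ c + u = a := by
  constructor
  · rintro ⟨hua, h⟩
    refine ⟨a - u, fun i hi => ?_, tsub_add_cancel_of_le hua⟩
    by_contra hiZ
    simp [h i hiZ] at hi
  · rintro ⟨c, hc, rfl⟩
    refine ⟨le_add_self, fun i hi => ?_⟩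
    have : c i = 0 := by
      by_contra h
      exact hi (hc (by simpa using h))
    simp [this]

lemma HasConePartition.mono {k l : ℕ} {P : Set (σ →₀ ℕ)} (h : HasConePartition k P)
    (hlk : l ≤ k) : HasConePartition l P := by
  obtain ⟨m, u, Z, hk, hd, hP⟩ := h
  exact ⟨m, u, Z, fun i => hlk.trans (hk i), hd, hP⟩

lemma HasConePartition.empty (k : ℕ) : HasConePartition k (∅ : Set (σ →₀ ℕ)) :=
  ⟨0, Fin.elim0, Fin.elim0, fun i => i.elim0, fun i => i.elim0, by simp⟩

lemma hasConePartition_cone (u : σ →₀ ℕ) (Z : Finset σ) :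
    HasConePartition Z.card (cone u Z) :=
  ⟨1, fun _ => u, fun _ => Z, fun _ => le_rfl, fun i j h => (h (Subsingleton.elim i j)).elim,
    Set.iUnion_const _⟩

lemma hasConePartition_singleton_zero : HasConePartition 0 ({0} : Set (σ →₀ ℕ)) := by
  convert! hasConePartition_cone (0 : σ →₀ ℕ) ∅
  ext a
  simp [cone, Finsupp.ext_iff]

lemma HasConePartition.union {k : ℕ} {P Q : Set (σ →₀ ℕ)} (hP : HasConePartition k P)
    (hQ : HasConePartition k Q) (hPQ : Disjoint P Q) : HasConePartition k (P ∪ Q) := by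
  obtain ⟨m, u, Z, hk, hd, rfl⟩ := hP
  obtain ⟨m', u', Z', hk', hd', rfl⟩ := hQ
  rw [Set.disjoint_iUnion_left] at hPQ
  simp only [Set.disjoint_iUnion_right] at hPQ
  refine ⟨m + m', Fin.append u u', Fin.append Z Z', fun i => ?_, fun i j hij => ?_, ?_⟩
  · induction i using Fin.addCases <;> simp [hk, hk']
  · induction i using Fin.addCases with
    | left i =>
      induction j using Fin.addCases with
      | left j => simpa using hd (fun h => hij (by rw [h]))
      | right j => simpa using hPQ i j
    | right i =>
      induction j using Fin.addCases with
      | left j => simpa using (hPQ j i).symm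
      | right j => simpa using hd' (fun h => hij (by rw [h]))
  · ext a
    simp only [Set.mem_iUnion, Set.mem_union]
    constructor
    · rintro ⟨i, hi⟩
      induction i using Fin.addCases with
      | left i => exact Or.inl ⟨i, by simpa using hi⟩
      | right i => exact Or.inr ⟨i, by simpa using hi⟩
    · rintro (⟨i, hi⟩ | ⟨i, hi⟩)
      · exact ⟨Fin.castAdd m' i, by simpa using hi⟩
      · exact ⟨Fin.natAdd m i, by simpa using hi⟩

/-- Freeing the variable `x` raises the dimension of all cones by one: `P` consists of monomials
not involving `x`, and they are multiplied by all the powers `x ^ e` with `c ≤ e`. -/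
lemma HasConePartition.lift {k : ℕ} {P : Set (σ →₀ ℕ)} (hP : HasConePartition k P) (x : σ)
    (hx : ∀ a ∈ P, a x = 0) (c : ℕ) :
    HasConePartition (k + 1) {a | c ≤ a x ∧ a.erase x ∈ P} := by
  classical
  obtain ⟨m, u, Z, hk, hd, rfl⟩ := hP
  simp only [Set.mem_iUnion, forall_exists_index] at hx
  have hu : ∀ i, u i x = 0 := fun i => hx _ i (self_mem_cone _ _)
  have hxZ : ∀ i, x ∉ Z i := by
    intro i hi
    have := hx (Finsupp.single x 1 + u i) i (mem_cone_iff_exists.2 ⟨_, fun j hj => ?_, rfl⟩)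
    · simp at this
    · rcases eq_or_ne j x with rfl | h
      · exact hi
      · simp [h] at hj
  have hcone : ∀ i, cone (Finsupp.single x c + u i) (insert x (Z i)) =
      {a | c ≤ a x ∧ a.erase x ∈ cone (u i) (Z i)} := by
    intro i
    ext a
    simp only [cone, Set.mem_ofPred_eq, Finsupp.le_def, Finset.mem_insert, not_or]
    constructor
    · rintro ⟨h1, h2⟩
      refine ⟨by simpa [hu] using h1 x, fun j => ?_, fun j hj => ?_⟩
      · by_cases hjx : j = x
        · simp [hjx, hu]
        · simpa [hjx, Finsupp.single_apply, Ne.symm hjx] using h1 j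
      · by_cases hjx : j = x
        · simp [hjx, hu]
        · simpa [hjx, Finsupp.single_apply, Ne.symm hjx] using h2 j ⟨hjx, hj⟩
    · rintro ⟨h0, h1, h2⟩
      refine ⟨fun j => ?_, fun j hj => ?_⟩
      · by_cases hjx : j = x
        · simpa [hjx, hu] using h0
        · simpa [hjx, Finsupp.single_apply, Ne.symm hjx] using h1 j
      · simpa [hj.1, Finsupp.single_apply, Ne.symm hj.1] using h2 j hj.2
  refine ⟨m, fun i => Finsupp.single x c + u i, fun i => insert x (Z i), fun i => ?_,
    fun i j hij => ?_, ?_⟩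
  · rw [Finset.card_insert_of_notMem (hxZ i)]
    exact Nat.succ_le_succ (hk i)
  · simp only [hcone]
    exact Set.disjoint_left.2 fun a hai haj => Set.disjoint_left.1 (hd hij) hai.2 haj.2
  · simp only [hcone]
    ext a
    simp

end Cones

/-! ### The rank of a set of exponents -/

section Rank

variable {σ : Type*}

/-- The exponent `a` with a last coordinate `1` appended: the exponent vector of `x^a t`, as an
element of a rational vector space. -/
def extVec (a : σ →₀ ℕ) : (σ → ℚ) × ℚ :=
  (fun i => (a i : ℚ), 1)

/-- The rank of the family of vectors `(a, 1)` for `a ∈ U`. -/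
noncomputable def extRank (U : Set (σ →₀ ℕ)) : ℕ :=
  Module.finrank ℚ (Submodule.span ℚ (extVec '' U))

variable [Finite σ]

lemma extRank_pos {U : Set (σ →₀ ℕ)} (hU : U.Nonempty) : 0 < extRank U := by
  obtain ⟨a, ha⟩ := hU
  have : Nontrivial (Submodule.span ℚ (extVec '' U)) :=
    ⟨⟨⟨extVec a, Submodule.subset_span ⟨a, ha, rfl⟩⟩, 0, fun h => by
      simpa [extVec] using congrArg Prod.snd (congrArg Subtype.val h)⟩⟩
  exact Module.finrank_pos

/-- Setting a variable to `1` does not raise the rank, since it is a linear operation. -/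
lemma extRank_erase_le (U : Set (σ →₀ ℕ)) (x : σ) :
    extRank ((fun a : σ →₀ ℕ => a.erase x) '' U) ≤ extRank U := by
  classical
  let f : (σ → ℚ) × ℚ →ₗ[ℚ] (σ → ℚ) × ℚ :=
    LinearMap.prodMap (LinearMap.pi fun i => if i = x then 0 else LinearMap.proj i) LinearMap.id
  have hf : ∀ a : σ →₀ ℕ, extVec (a.erase x) = f (extVec a) := by
    intro a
    refine Prod.ext (funext fun i => ?_) rfl
    by_cases hi : i = x <;> simp [f, extVec, hi]
  have : extVec '' ((fun a : σ →₀ ℕ => a.erase x) '' U) = f '' (extVec '' U) := by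
    simp only [Set.image_image, hf]
  rw [extRank, extRank, this, Submodule.span_image]
  exact Submodule.finrank_map_le _ _

/-- Discarding the exponents that involve a variable lowers the rank, since the vectors that
remain lie in a coordinate hyperplane. -/
lemma extRank_avoiding_lt {U : Set (σ →₀ ℕ)} {x : σ} (hx : ∃ a ∈ U, a x ≠ 0) :
    extRank {a ∈ U | a x = 0} < extRank U := by
  obtain ⟨a, haU, hax⟩ := hx
  let f : (σ → ℚ) × ℚ →ₗ[ℚ] ℚ := LinearMap.proj x ∘ₗ LinearMap.fst ℚ _ _
  refine Submodule.finrank_lt_finrank_of_lt (lt_of_le_of_ne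
    (Submodule.span_mono (Set.image_mono (Set.sep_subset _ _))) fun h => ?_)
  have hker : Submodule.span ℚ (extVec '' {a ∈ U | a x = 0}) ≤ LinearMap.ker f := by
    rw [Submodule.span_le]
    rintro _ ⟨b, ⟨-, hb⟩, rfl⟩
    simp [f, extVec, hb]
  rw [h] at hker
  have := hker (Submodule.subset_span ⟨a, haU, rfl⟩)
  exact hax (by simpa [f, extVec] using this)

end Rank

/-! ### Cone partitions for squarefree monomial ideals -/

section Squarefree

variable {σ : Type*}

/-- The exponents of the monomials in the variables `W` that are divisible by some `x^u`
with `u ∈ U`. -/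
def multiples (W : Finset σ) (U : Set (σ →₀ ℕ)) : Set (σ →₀ ℕ) :=
  {a | (∀ i ∉ W, a i = 0) ∧ ∃ u ∈ U, u ≤ a}

/-- The exponents of the monomials in the variables `W` that are divisible by no `x^u`
with `u ∈ U`. -/
def nonmultiples (W : Finset σ) (U : Set (σ →₀ ℕ)) : Set (σ →₀ ℕ) :=
  {a | (∀ i ∉ W, a i = 0) ∧ ∀ u ∈ U, ¬ u ≤ a}

lemma erase_eq_zero_off_iff [DecidableEq σ] {W : Finset σ} {x : σ} (hxW : x ∉ W) (a : σ →₀ ℕ) :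
    (∀ i ∉ W, a.erase x i = 0) ↔ ∀ i ∉ insert x W, a i = 0 := by
  refine forall_congr' fun i => ?_
  by_cases hi : i = x <;> simp [hi, hxW]

lemma erase_le_erase_iff {u a : σ →₀ ℕ} {x : σ} (h : u x ≤ a x) :
    u.erase x ≤ a.erase x ↔ u ≤ a := by
  classical
  simp only [Finsupp.le_def]
  refine forall_congr' fun i => ?_
  by_cases hi : i = x <;> simp [hi, h]

lemma mem_multiples_iff_erase [DecidableEq σ] {W : Finset σ} {x : σ} (hxW : x ∉ W)
    {U : Set (σ →₀ ℕ)} {a : σ →₀ ℕ} (h : ∀ u ∈ U, u x ≤ a x) :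
    a ∈ multiples (insert x W) U ↔
      a.erase x ∈ multiples W ((fun u : σ →₀ ℕ => u.erase x) '' U) := by
  refine and_congr (erase_eq_zero_off_iff hxW a).symm ?_
  rw [Set.exists_mem_image]
  exact exists_congr fun u => and_congr_right fun hu => (erase_le_erase_iff (h u hu)).symm

lemma mem_nonmultiples_iff_erase [DecidableEq σ] {W : Finset σ} {x : σ} (hxW : x ∉ W)
    {U : Set (σ →₀ ℕ)} {a : σ →₀ ℕ} (h : ∀ u ∈ U, u x ≤ a x) :
    a ∈ nonmultiples (insert x W) U ↔
      a.erase x ∈ nonmultiples W ((fun u : σ →₀ ℕ => u.erase x) '' U) := by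
  refine and_congr (erase_eq_zero_off_iff hxW a).symm ?_
  rw [Set.forall_mem_image]
  exact forall₂_congr fun u hu => not_congr (erase_le_erase_iff (h u hu)).symm

lemma eq_zero_off_insert_iff [DecidableEq σ] {W : Finset σ} {x : σ} {a : σ →₀ ℕ} (ha : a x = 0) :
    (∀ i ∉ insert x W, a i = 0) ↔ ∀ i ∉ W, a i = 0 := by
  refine forall_congr' fun i => ?_
  by_cases hi : i = x <;> simp [hi, ha]

lemma apply_eq_zero_of_le {u a : σ →₀ ℕ} {x : σ} (h : u ≤ a) (ha : a x = 0) : u x = 0 :=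
  Nat.le_zero.1 (ha ▸ h x)

lemma mem_multiples_iff_avoiding [DecidableEq σ] {W : Finset σ} {x : σ} {U : Set (σ →₀ ℕ)}
    {a : σ →₀ ℕ} (ha : a x = 0) :
    a ∈ multiples (insert x W) U ↔ a ∈ multiples W {u ∈ U | u x = 0} := by
  refine and_congr (eq_zero_off_insert_iff ha) ⟨?_, ?_⟩
  · rintro ⟨u, hu, hua⟩
    exact ⟨u, ⟨hu, apply_eq_zero_of_le hua ha⟩, hua⟩
  · rintro ⟨u, ⟨hu, -⟩, hua⟩
    exact ⟨u, hu, hua⟩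

lemma mem_nonmultiples_iff_avoiding [DecidableEq σ] {W : Finset σ} {x : σ} {U : Set (σ →₀ ℕ)}
    {a : σ →₀ ℕ} (ha : a x = 0) :
    a ∈ nonmultiples (insert x W) U ↔ a ∈ nonmultiples W {u ∈ U | u x = 0} :=
  and_congr (eq_zero_off_insert_iff ha)
    ⟨fun h u hu => h u hu.1, fun h u hu hua => h u ⟨hu, apply_eq_zero_of_le hua ha⟩ hua⟩

/-- A set `P` of monomials is split into the monomials not involving `x` and those divisible
by `x`. The cones for the second part gain the free variable `x`. -/
lemma HasConePartition.of_split {k : ℕ} {x : σ} {P P₀ P₁ : Set (σ →₀ ℕ)}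
    (h₀ : ∀ a, a x = 0 → (a ∈ P ↔ a ∈ P₀)) (hP₀ : ∀ a ∈ P₀, a x = 0)
    (h₁ : ∀ a, 1 ≤ a x → (a ∈ P ↔ a.erase x ∈ P₁)) (hP₁ : ∀ a ∈ P₁, a x = 0)
    (hk₀ : HasConePartition k P₀) (hk₁ : HasConePartition (k - 1) P₁) :
    HasConePartition k P := by
  have hP : P = P₀ ∪ {a | 1 ≤ a x ∧ a.erase x ∈ P₁} := by
    ext a
    rcases Nat.eq_zero_or_pos (a x) with ha | ha
    · simp [h₀ a ha, ha]
    · have : a ∉ P₀ := fun h => ha.ne' (hP₀ a h)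
      simp [h₁ a ha, this, Nat.one_le_iff_ne_zero, ha.ne']
  rw [hP]
  refine hk₀.union ((hk₁.lift x hP₁ 1).mono (by omega))
    (Set.disjoint_left.2 fun a ha ha' => ?_)
  have := hP₀ a ha
  have := ha'.1
  omega

lemma image_erase_eq_self {U : Set (σ →₀ ℕ)} {x : σ} (h : ∀ u ∈ U, u x = 0) :
    (fun u : σ →₀ ℕ => u.erase x) '' U = U := by
  refine (Set.image_congr fun u hu => ?_).trans (Set.image_id U)
  exact Finsupp.erase_of_notMem_support (by simpa using h u hu)

variable [Finite σ]

/-- For squarefree `U`, the multiples of `U` have a cone partition in dimension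
`|W| + 1 - extRank U`. One variable `x` at a time is removed: both the deletion (the elements of
`U` not involving `x`) and the contraction (the elements of `U` with `x` set to `1`) involve one
variable fewer; in the deletion the rank drops, and in the contraction the cones gain the free
variable `x`. -/
theorem hasConePartition_multiples (W : Finset σ) (U : Set (σ →₀ ℕ))
    (hsq : ∀ u ∈ U, ∀ i, u i ≤ 1) (hUW : ∀ u ∈ U, ∀ i ∉ W, u i = 0) :
    HasConePartition (W.card + 1 - extRank U) (multiples W U) := by
  classical
  induction W using Finset.induction_on generalizing U with
  | empty =>
    have hU0 : ∀ u ∈ U, u = 0 := fun u hu => Finsupp.ext fun i => hUW u hu i (by simp)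
    rcases U.eq_empty_or_nonempty with rfl | ⟨u, hu⟩
    · convert! HasConePartition.empty (σ := σ) _
      simp [multiples]
    · have : multiples ∅ U = {0} := by
        refine Set.eq_singleton_iff_unique_mem.2 ⟨⟨by simp, u, hu, (hU0 u hu).le⟩, fun a ha => ?_⟩
        exact Finsupp.ext fun i => ha.1 i (by simp)
      rw [this]
      refine hasConePartition_singleton_zero.mono ?_
      have := extRank_pos ⟨u, hu⟩
      simp only [Finset.card_empty]
      omega
  | insert x W hxW ih =>
    have hcard := Finset.card_insert_of_notMem hxW
    -- Setting `x` to `1` preserves the assumptions on `U`.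
    have ih₁ := ih ((fun u : σ →₀ ℕ => u.erase x) '' U)
      (by
        rintro _ ⟨u, hu, rfl⟩ i
        by_cases hi : i = x <;> simp [hi, hsq u hu])
      (by
        rintro _ ⟨u, hu, rfl⟩
        exact (erase_eq_zero_off_iff hxW u).2 (hUW u hu))
    by_cases hx : ∃ u ∈ U, u x ≠ 0
    · have h₀ := extRank_avoiding_lt hx
      have h₁ := extRank_erase_le U x
      refine HasConePartition.of_split (x := x) (fun a => mem_multiples_iff_avoiding)
        (fun a ha => ha.1 x hxW)
        (fun a ha => mem_multiples_iff_erase hxW fun u hu => (hsq u hu x).trans ha)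
        (fun a ha => ha.1 x hxW) ((ih {u ∈ U | u x = 0} (fun u hu => hsq u hu.1) ?_).mono ?_)
        (ih₁.mono ?_)
      · exact fun u hu => (eq_zero_off_insert_iff hu.2).1 (hUW u hu.1)
      · omega
      · omega
    · push Not at hx
      rw [image_erase_eq_self hx] at ih₁
      convert! (ih₁.lift x (fun a ha => ha.1 x hxW) 0).mono (l := _) ?_
      · ext a
        rw [mem_multiples_iff_erase hxW fun u hu => (hx u hu).trans_le (Nat.zero_le _),
          image_erase_eq_self hx]
        simp
      · omega

/-- For squarefree `U`, the nonmultiples of `U` have a cone partition in dimension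
`|W| - extRank U`. The induction is that of `hasConePartition_multiples`. -/
theorem hasConePartition_nonmultiples (W : Finset σ) (U : Set (σ →₀ ℕ))
    (hsq : ∀ u ∈ U, ∀ i, u i ≤ 1) (hUW : ∀ u ∈ U, ∀ i ∉ W, u i = 0) :
    HasConePartition (W.card - extRank U) (nonmultiples W U) := by
  classical
  induction W using Finset.induction_on generalizing U with
  | empty =>
    rw [Finset.card_empty, Nat.zero_sub]
    rcases U.eq_empty_or_nonempty with rfl | ⟨u, hu⟩
    · convert! hasConePartition_singleton_zero (σ := σ)
      ext a
      simp [nonmultiples, Finsupp.ext_iff]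
    · convert! HasConePartition.empty (σ := σ) 0
      refine Set.eq_empty_of_forall_notMem fun a ha => ha.2 u hu fun i => ?_
      simp [hUW u hu i (by simp)]
  | insert x W hxW ih =>
    have hcard := Finset.card_insert_of_notMem hxW
    -- Setting `x` to `1` preserves the assumptions on `U`.
    have ih₁ := ih ((fun u : σ →₀ ℕ => u.erase x) '' U)
      (by
        rintro _ ⟨u, hu, rfl⟩ i
        by_cases hi : i = x <;> simp [hi, hsq u hu])
      (by
        rintro _ ⟨u, hu, rfl⟩
        exact (erase_eq_zero_off_iff hxW u).2 (hUW u hu))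
    by_cases hx : ∃ u ∈ U, u x ≠ 0
    · have h₀ := extRank_avoiding_lt hx
      have h₁ := extRank_erase_le U x
      refine HasConePartition.of_split (x := x) (fun a => mem_nonmultiples_iff_avoiding)
        (fun a ha => ha.1 x hxW)
        (fun a ha => mem_nonmultiples_iff_erase hxW fun u hu => (hsq u hu x).trans ha)
        (fun a ha => ha.1 x hxW) ((ih {u ∈ U | u x = 0} (fun u hu => hsq u hu.1) ?_).mono ?_)
        (ih₁.mono ?_)
      · exact fun u hu => (eq_zero_off_insert_iff hu.2).1 (hUW u hu.1)
      · omega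
      · omega
    · push Not at hx
      rw [image_erase_eq_self hx] at ih₁
      convert! (ih₁.lift x (fun a ha => ha.1 x hxW) 0).mono (l := _) ?_
      · ext a
        rw [mem_nonmultiples_iff_erase hxW fun u hu => (hx u hu).trans_le (Nat.zero_le _),
          image_erase_eq_self hx]
        simp
      · omega

end Squarefree

/-! ### Stanley decompositions from cone partitions -/

section Transfer

variable {K : Type*} [Field K] {n : ℕ}

section Basis

variable {M : Type*} [AddCommGroup M] [Module K M] [Module (MvPolynomial (Fin n) K) M]
  [IsScalarTower K (MvPolynomial (Fin n) K) M] {P : Set (Fin n →₀ ℕ)}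

lemma supported_toSubmodule_eq_span (Z : Finset (Fin n)) :
    Subalgebra.toSubmodule (supported K (Z : Set (Fin n))) =
      Submodule.span K ((fun c => monomial c (1 : K)) '' {c | (c.support : Set (Fin n)) ⊆ Z}) := by
  change _ = Submodule.span K ((monomial · (1 : K)) '' _)
  rw [← restrictSupport_eq_span]
  ext p
  rw [Subalgebra.mem_toSubmodule, mem_supported, mem_restrictSupport_iff]
  simp only [Set.subset_def, Finset.mem_coe, mem_vars_iff_mem_support, Set.mem_ofPred_eq]
  grind

lemma stanleySpace_eq_span (b : Module.Basis P K M)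
    (hb : ∀ (a : P) (c : Fin n →₀ ℕ) (h : c + a ∈ P), monomial c (1 : K) • b a = b ⟨c + a, h⟩)
    (u : P) {Z : Finset (Fin n)} (hZ : cone (u : Fin n →₀ ℕ) Z ⊆ P) :
    stanleySpace (K := K) (b u) Z = Submodule.span K (b '' {a | (a : Fin n →₀ ℕ) ∈ cone u Z}) := by
  rw [stanleySpace, supported_toSubmodule_eq_span, Submodule.map_span, ← Set.image_comp]
  congr 1
  ext m
  constructor
  · rintro ⟨c, hc, rfl⟩
    have h : c + u ∈ cone (u : Fin n →₀ ℕ) Z := mem_cone_iff_exists.2 ⟨c, hc, rfl⟩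
    exact ⟨⟨c + u, hZ h⟩, h, (hb u c (hZ h)).symm⟩
  · rintro ⟨⟨a, haP⟩, ha, rfl⟩
    obtain ⟨c, hc, rfl⟩ := mem_cone_iff_exists.1 ha
    exact ⟨c, hc, hb u c haP⟩

lemma eq_zero_of_smul_basis_eq_zero (b : Module.Basis P K M)
    (hb : ∀ (a : P) (c : Fin n →₀ ℕ) (h : c + a ∈ P), monomial c (1 : K) • b a = b ⟨c + a, h⟩)
    (u : P) {Z : Finset (Fin n)} (hZ : cone (u : Fin n →₀ ℕ) Z ⊆ P)
    {v : MvPolynomial (Fin n) K} (hv : v ∈ supported K (Z : Set (Fin n))) (h : v • b u = 0) :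
    v = 0 := by
  have hmem : ∀ c ∈ v.support, c + u ∈ P := fun c hc =>
    hZ (mem_cone_iff_exists.2 ⟨c, fun i hi => mem_supported.1 hv
      ((mem_vars_iff_mem_support _).2 ⟨c, hc, hi⟩), rfl⟩)
  have hsum : ∑ c : v.support, coeff c.1 v • b ⟨c.1 + u, hmem c.1 c.2⟩ = 0 := by
    rw [← h]
    conv_rhs => rw [v.as_sum, Finset.sum_smul, ← Finset.sum_coe_sort]
    refine Finset.sum_congr rfl fun c _ => ?_
    rw [← hb u c.1 (hmem c.1 c.2), ← smul_assoc, smul_monomial, smul_eq_mul, mul_one]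
  have hli : LinearIndependent K fun c : v.support => b ⟨c.1 + u, hmem c.1 c.2⟩ :=
    b.linearIndependent.comp _ fun c c' hcc => by
      exact Subtype.ext (add_right_cancel (congrArg Subtype.val hcc))
  ext c
  by_contra hc
  exact hc (Fintype.linearIndependent_iff.1 hli _ hsum ⟨c, mem_support_iff.2 hc⟩)

/-- If `M` has a homogeneous basis indexed by a set `P` of exponents, on which monomials act by
translation, then a cone partition of `P` gives a Stanley decomposition of `M`. -/
theorem le_sdepth_of_hasConePartition (b : Module.Basis P K M)
    (hb : ∀ (a : P) (c : Fin n →₀ ℕ) (h : c + a ∈ P), monomial c (1 : K) • b a = b ⟨c + a, h⟩)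
    {𝓜 : (Fin n → ℤ) → Submodule K M} (hom : ∀ a : P, ∃ d, b a ∈ 𝓜 d) {k : ℕ}
    (hP : HasConePartition k P) : (k : ℕ∞) ≤ sdepth 𝓜 := by
  obtain ⟨m, u, Z, hk, hd, hU⟩ := hP
  have hZ : ∀ i, cone (u i) (Z i) ⊆ P := fun i => hU ▸ Set.subset_iUnion (fun i => cone _ _) i
  let u' : Fin m → P := fun i => ⟨u i, hZ i (self_mem_cone _ _)⟩
  have hspan : ∀ i, stanleySpace (K := K) (b (u' i)) (Z i) =
      Submodule.span K (b '' {a | (a : Fin n →₀ ℕ) ∈ cone (u i) (Z i)}) := fun i =>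
    stanleySpace_eq_span b hb (u' i) (hZ i)
  let D : StanleyDecomposition 𝓜 :=
    { m := m
      u := fun i => b (u' i)
      Z := Z
      homogeneous := fun i => hom _
      free := fun i v hv h => eq_zero_of_smul_basis_eq_zero b hb (u' i) (hZ i) hv h
      isInternal := by
        rw [DirectSum.isInternal_submodule_iff_iSupIndep_and_iSup_eq_top]
        simp only [hspan]
        refine ⟨fun i => ?_, ?_⟩
        · simp only [← Submodule.span_iUnion, ← Set.image_iUnion]
          refine b.linearIndependent.disjoint_span_image (Set.disjoint_left.2 fun a hai haj => ?_)
          simp only [Set.mem_iUnion] at haj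
          obtain ⟨j, hji, haj⟩ := haj
          exact Set.disjoint_left.1 (hd hji) haj hai
        · rw [← Submodule.span_iUnion, ← Set.image_iUnion, ← b.span_eq, ← Set.image_univ]
          congr 2
          refine Set.eq_univ_of_forall fun a => ?_
          have ha : (a : Fin n →₀ ℕ) ∈ ⋃ i, cone (u i) (Z i) := hU.symm ▸ a.2
          simpa using ha }
  refine le_trans ?_ (le_iSup (fun D : StanleyDecomposition 𝓜 => D.sdepth) D)
  exact le_iInf fun i => Nat.cast_le.2 (hk i)

end Basis

lemma monomial_mem_fineGrading (a : Fin n →₀ ℕ) (r : K) :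
    ∃ d, monomial a r ∈ fineGrading K n d :=
  ⟨_, (mem_weightedHomogeneousSubmodule _ _ _ _).2 (isWeightedHomogeneous_monomial _ _ _ rfl)⟩

/-- The monomial ideal with generators `x^u`, `u ∈ U`. -/
noncomputable abbrev monomialIdeal (K : Type*) [Field K] (U : Set (Fin n →₀ ℕ)) :
    Ideal (MvPolynomial (Fin n) K) :=
  Ideal.span ((fun a => monomial a (1 : K)) '' U)

lemma monomialIdeal_restrictScalars (U : Set (Fin n →₀ ℕ)) :
    (monomialIdeal K U).restrictScalars K = restrictSupport K (multiples Finset.univ U) := by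
  ext p
  rw [Submodule.restrictScalars_mem, mem_ideal_span_monomial_image, mem_restrictSupport_iff]
  simp [multiples, Set.subset_def]

lemma coe_basisRestrictSupport (s : Set (Fin n →₀ ℕ)) (a : s) :
    (basisRestrictSupport K s a : MvPolynomial (Fin n) K) = monomial (a : Fin n →₀ ℕ) 1 := by
  classical
  have : basisRestrictSupport K s a = ⟨monomial (a : Fin n →₀ ℕ) 1,
      (monomial_mem_restrictSupport K).2 (Or.inl a.2)⟩ := by
    rw [Module.Basis.apply_eq_iff]
    ext i
    change coeff (i : Fin n →₀ ℕ) (monomial (a : Fin n →₀ ℕ) (1 : K)) = _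
    rw [coeff_monomial, Finsupp.single_apply]
    simp [Subtype.ext_iff]
  rw [this]

theorem le_sdepth_idealGrading {U : Set (Fin n →₀ ℕ)} {k : ℕ}
    (h : HasConePartition k (multiples Finset.univ U)) :
    (k : ℕ∞) ≤ sdepth (idealGrading (monomialIdeal K U)) := by
  let b : Module.Basis (multiples Finset.univ U) K (monomialIdeal K U) :=
    (basisRestrictSupport K (multiples Finset.univ U)).map
      (LinearEquiv.ofEq _ _ (monomialIdeal_restrictScalars U).symm)
  have hbc : ∀ a, (b a : MvPolynomial (Fin n) K) = monomial a 1 := fun a =>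
    coe_basisRestrictSupport _ a
  refine le_sdepth_of_hasConePartition b (fun a c hca => ?_) (fun a => ?_) h
  · refine Subtype.ext ?_
    rw [Submodule.coe_smul, hbc, hbc, smul_eq_mul, monomial_mul, one_mul]
  · obtain ⟨d, hd⟩ := monomial_mem_fineGrading (n := n) (a : Fin n →₀ ℕ) (1 : K)
    exact ⟨d, show (b a : MvPolynomial (Fin n) K) ∈ _ by rwa [hbc]⟩

lemma isCompl_restrictSupport (P : Set (Fin n →₀ ℕ)) :
    IsCompl (restrictSupport K P) (restrictSupport K Pᶜ) := by
  let b := MvPolynomial.basisMonomials (Fin n) K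
  rw [restrictSupport_eq_span, restrictSupport_eq_span]
  refine ⟨b.linearIndependent.disjoint_span_image disjoint_compl_right, ?_⟩
  rw [codisjoint_iff, ← Submodule.span_union, ← Set.image_union, Set.union_compl_self,
    Set.image_univ]
  exact b.span_eq

theorem le_sdepth_quotientGrading {U : Set (Fin n →₀ ℕ)} {k : ℕ}
    (h : HasConePartition k (nonmultiples Finset.univ U)) :
    (k : ℕ∞) ≤ sdepth (quotientGrading (monomialIdeal K U)) := by
  have hcompl : nonmultiples Finset.univ U = (multiples Finset.univ U)ᶜ := by
    ext a
    simp [nonmultiples, multiples]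
  have hc : IsCompl ((monomialIdeal K U).restrictScalars K)
      (restrictSupport K (nonmultiples Finset.univ U)) := by
    rw [monomialIdeal_restrictScalars, hcompl]
    exact isCompl_restrictSupport _
  let b : Module.Basis (nonmultiples Finset.univ U) K (MvPolynomial (Fin n) K ⧸ monomialIdeal K U) :=
    (basisRestrictSupport K (nonmultiples Finset.univ U)).map
      ((Submodule.quotientEquivOfIsCompl _ _ hc).symm.trans
        (Submodule.Quotient.restrictScalarsEquiv K (monomialIdeal K U)))
  have hbc : ∀ a, b a = Submodule.Quotient.mk (monomial (a : Fin n →₀ ℕ) (1 : K)) := fun a =>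
    congrArg Submodule.Quotient.mk (coe_basisRestrictSupport _ a)
  refine le_sdepth_of_hasConePartition b (fun a c hca => ?_) (fun a => ?_) h
  · rw [hbc, hbc, ← Submodule.Quotient.mk_smul, smul_eq_mul, monomial_mul, one_mul]
  · obtain ⟨d, hd⟩ := monomial_mem_fineGrading (n := n) (a : Fin n →₀ ℕ) (1 : K)
    exact ⟨d, _, hd, (hbc a).symm⟩

end Transfer

/-! ### Lower bounds for Krull dimension -/

section KrullDimension

universe v

lemma ringKrullDim_le_of_injective_of_isIntegral {R S : Type*} [CommRing R] [CommRing S]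
    [Algebra R S] [Algebra.IsIntegral R S] (h : Function.Injective (algebraMap R S)) :
    ringKrullDim R ≤ ringKrullDim S := by
  refine iSup_le fun l => ?_
  obtain ⟨P, hP, hPl⟩ := Ideal.exists_ideal_over_prime_of_isIntegral
    (RelSeries.head l).asIdeal (⊥ : Ideal S) (by
      rw [← RingHom.ker_eq_comap_bot, (RingHom.injective_iff_ker_eq_bot _).1 h]
      exact bot_le)
  have : P.IsPrime := hPl.1
  have : P.LiesOver (RelSeries.head l).asIdeal := ⟨hPl.2.symm⟩
  obtain ⟨L, hL, -⟩ := Ideal.exists_ltSeries_of_hasGoingUp l P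
  rw [← hL]
  exact le_iSup (fun L : LTSeries (PrimeSpectrum S) => (L.length : WithBot ℕ∞)) L

lemma natCast_le_ringKrullDim_of_injective_of_isDomain {K T : Type v} [Field K] [CommRing T]
    [IsDomain T] [Algebra K T] [Algebra.FiniteType K T] {r : ℕ}
    (g : MvPolynomial (Fin r) K →ₐ[K] T) (hg : Function.Injective g) :
    (r : WithBot ℕ∞) ≤ ringKrullDim T := by
  obtain ⟨s, f, hf, hint⟩ := exists_integral_inj_algHom_of_fg K T
  algebraize [f.toRingHom]
  have : IsScalarTower K (MvPolynomial (Fin s) K) T :=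
    IsScalarTower.of_algebraMap_eq fun x => (f.commutes x).symm
  have : FaithfulSMul (MvPolynomial (Fin s) K) T :=
    (faithfulSMul_iff_algebraMap_injective _ _).2 hf
  have hs : Algebra.trdeg K T = s := by
    rw [← trdeg_add_eq K (MvPolynomial (Fin s) K),
      trdeg_eq_zero (R := MvPolynomial (Fin s) K),
      MvPolynomial.trdeg_of_isDomain]
    simp
  have hr : (r : Cardinal.{v}) ≤ Algebra.trdeg K T := by
    simpa [MvPolynomial.trdeg_of_isDomain] using trdeg_le_of_injective g hg
  have hrs : r ≤ s := by rwa [hs, Nat.cast_le] at hr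
  calc (r : WithBot ℕ∞) ≤ s := by exact_mod_cast hrs
    _ = ringKrullDim (MvPolynomial (Fin s) K) := by
      simp [MvPolynomial.ringKrullDim_of_isNoetherianRing]
    _ ≤ ringKrullDim T := ringKrullDim_le_of_injective_of_isIntegral hf

/-- The dimension of a finitely generated algebra is at least the number of any algebraically
independent elements. Some prime lies over the zero ideal of the polynomial ring they generate, so
that one may pass to a domain. -/
theorem natCast_le_ringKrullDim_of_injective {K F : Type v} [Field K] [CommRing F]
    [Algebra K F] [Algebra.FiniteType K F] {r : ℕ}
    (g : MvPolynomial (Fin r) K →ₐ[K] F) (hg : Function.Injective g) :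
    (r : WithBot ℕ∞) ≤ ringKrullDim F := by
  obtain ⟨Q, hQ, hQg⟩ := Ideal.exists_comap_eq_of_mem_minimalPrimes_of_injective
    (f := (g : MvPolynomial (Fin r) K →+* F)) hg ⊥ (by simp [IsDomain.minimalPrimes_eq_singleton_bot])
  refine (natCast_le_ringKrullDim_of_injective_of_isDomain
    ((Ideal.Quotient.mkₐ K Q).comp g) ?_).trans (ringKrullDim_quotient_le Q)
  rw [injective_iff_map_eq_zero]
  intro p hp
  have : p ∈ Q.comap (g : MvPolynomial (Fin r) K →+* F) :=
    Ideal.mem_comap.2 (Ideal.Quotient.eq_zero_iff_mem.1 hp)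
  rwa [hQg] at this

lemma exists_ringKrullDim_eq_natCast (K F : Type*) [Field K] [CommRing F] [Nontrivial F]
    [Algebra K F] [Algebra.FiniteType K F] : ∃ l : ℕ, ringKrullDim F = l := by
  obtain ⟨m, f, hf⟩ := Algebra.FiniteType.iff_quotient_mvPolynomial''.mp ‹Algebra.FiniteType K F›
  have h1 : ringKrullDim F ≤ m := (ringKrullDim_le_of_surjective f.toRingHom hf).trans_eq
    (by simp [MvPolynomial.ringKrullDim_of_isNoetherianRing])
  have h0 : 0 ≤ ringKrullDim F := ringKrullDim_nonneg_of_nontrivial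
  generalize ringKrullDim F = d at h0 h1
  induction d with
  | bot => simp at h0
  | coe d =>
    induction d with
    | top => exact absurd (WithBot.coe_le_coe.1 h1) (by simp)
    | coe d => exact ⟨d, rfl⟩

end KrullDimension

/-! ### The analytic spread of a monomial ideal generated in one degree -/

section AnalyticSpread

variable {K : Type*} [Field K] {n : ℕ}

instance (I : Ideal (MvPolynomial (Fin n) K)) : Algebra.FiniteType K (FibreRing I) :=
  have : Algebra.FiniteType K (reesAlgebra I) :=
    Algebra.FiniteType.trans (S := MvPolynomial (Fin n) K) inferInstance inferInstance
  this.of_surjective (Ideal.Quotient.mkₐ K _) (Ideal.Quotient.mkₐ_surjective K _)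

/-- The coefficient of `t^k` in an element of `𝔪 𝓡(I)` has order larger than `d * k`, if the
elements of `I` have order at least `d`. -/
lemma coeff_mem_pow_of_mem_map {I : Ideal (MvPolynomial (Fin n) K)} {d : ℕ}
    (hI : I ≤ idealOfVars (Fin n) K ^ d) {f : reesAlgebra I}
    (hf : f ∈ (gradedMaximalIdeal K n).map
      (algebraMap (MvPolynomial (Fin n) K) (reesAlgebra I))) (k : ℕ) :
    (f : Polynomial (MvPolynomial (Fin n) K)).coeff k ∈ idealOfVars (Fin n) K ^ (d * k + 1) := by
  let J : Ideal (reesAlgebra I) :=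
    { carrier := {f | ∀ k, (f : Polynomial (MvPolynomial (Fin n) K)).coeff k ∈
        idealOfVars (Fin n) K ^ (d * k + 1)}
      zero_mem' := fun k => by simp
      add_mem' := fun {f g} hf hg k => by simpa using Ideal.add_mem _ (hf k) (hg k)
      smul_mem' := fun f g hg k => by
        change ((f : Polynomial (MvPolynomial (Fin n) K)) * g).coeff k ∈ _
        rw [Polynomial.coeff_mul]
        refine Ideal.sum_mem _ fun ij hij => ?_
        have hf : (f : Polynomial (MvPolynomial (Fin n) K)).coeff ij.1 ∈
            idealOfVars (Fin n) K ^ (d * ij.1) := by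
          rw [pow_mul]
          exact Ideal.pow_right_mono hI _ (f.2 ij.1)
        rw [← Finset.HasAntidiagonal.mem_antidiagonal.1 hij, mul_add, add_assoc, pow_add]
        exact Ideal.mul_mem_mul hf (hg ij.2) }
  suffices h : (gradedMaximalIdeal K n).map
      (algebraMap (MvPolynomial (Fin n) K) (reesAlgebra I)) ≤ J from h hf k
  rw [gradedMaximalIdeal, Ideal.map_span, Ideal.span_le]
  rintro _ ⟨_, ⟨i, rfl⟩, rfl⟩ k
  change (Polynomial.C (X i)).coeff k ∈ _
  rw [Polynomial.coeff_C]
  split_ifs with hk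
  · subst hk
    simpa using Ideal.subset_span (Set.mem_range_self i)
  · exact zero_mem _

/-- The element `x^a t` of the Rees algebra. -/
noncomputable def reesMonomial (I : Ideal (MvPolynomial (Fin n) K)) (a : Fin n →₀ ℕ)
    (ha : monomial a (1 : K) ∈ I) : reesAlgebra I :=
  ⟨Polynomial.monomial 1 (monomial a 1), reesAlgebra.monomial_mem.2 (by rwa [pow_one])⟩

lemma prod_monomial_pow {r : ℕ} (a : Fin r → Fin n →₀ ℕ) (c : Fin r →₀ ℕ) :
    ∏ j, (Polynomial.monomial 1 (monomial (a j) (1 : K))) ^ c j =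
      Polynomial.monomial c.degree (monomial (∑ j, c j • a j) (1 : K)) := by
  have (s : Finset (Fin r)) :
      ∏ j ∈ s, (Polynomial.monomial 1 (monomial (a j) (1 : K))) ^ c j =
        Polynomial.monomial (∑ j ∈ s, c j) (monomial (∑ j ∈ s, c j • a j) (1 : K)) := by
    classical
    induction s using Finset.induction_on with
    | empty => simp
    | insert j s hj ih =>
      rw [Finset.prod_insert hj, ih, Polynomial.monomial_pow, MvPolynomial.monomial_pow,
        Polynomial.monomial_mul_monomial, MvPolynomial.monomial_mul, Finset.sum_insert hj,
        Finset.sum_insert hj, one_pow, one_mul, one_mul]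
  rw [this, Finsupp.degree_eq_sum]

/-- The polynomial `p` evaluated at the elements `x^(a j) t`. -/
lemma coe_aeval_reesMonomial {I : Ideal (MvPolynomial (Fin n) K)} {r : ℕ}
    (a : Fin r → Fin n →₀ ℕ) (ha : ∀ j, monomial (a j) (1 : K) ∈ I)
    (p : MvPolynomial (Fin r) K) :
    (aeval (fun j => reesMonomial I (a j) (ha j)) p : Polynomial (MvPolynomial (Fin n) K)) =
      ∑ c ∈ p.support, Polynomial.monomial c.degree (monomial (∑ j, c j • a j) (coeff c p)) := by
  conv_lhs => rw [p.as_sum, map_sum, AddSubmonoidClass.coe_finsetSum]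
  refine Finset.sum_congr rfl fun c _ => ?_
  rw [aeval_monomial, Finsupp.prod_fintype _ _ (fun _ => pow_zero _), ← Algebra.smul_def]
  change coeff c p • (((∏ j, reesMonomial I (a j) (ha j) ^ c j : reesAlgebra I)) :
    Polynomial (MvPolynomial (Fin n) K)) = _
  rw [SubmonoidClass.coe_finsetProd]
  change coeff c p • (∏ j, (Polynomial.monomial 1 (monomial (a j) (1 : K))) ^ c j) = _
  rw [prod_monomial_pow, Polynomial.smul_monomial, MvPolynomial.smul_monomial, smul_eq_mul, mul_one]

lemma extVec_sum {σ : Type*} {r : ℕ} (a : Fin r → σ →₀ ℕ) (c : Fin r →₀ ℕ) :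
    ∑ j, (c j : ℚ) • extVec (a j) =
      ((fun i => (((∑ j, c j • a j : σ →₀ ℕ) i : ℕ) : ℚ)), ((c.degree : ℕ) : ℚ)) := by
  refine Prod.ext (funext fun i => ?_) ?_
  · simp [extVec, Prod.fst_sum, Finset.sum_apply, Finsupp.finsetSum_apply]
  · simp [extVec, Prod.snd_sum, Finsupp.degree_eq_sum]

/-- If the vectors `(a j, 1)` are linearly independent, then the monomials `x^(a j) t` are
algebraically independent: distinct monomials in them are distinct monomials of `S[t]`. -/
lemma coeff_aeval_reesMonomial {I : Ideal (MvPolynomial (Fin n) K)} {r : ℕ}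
    {a : Fin r → Fin n →₀ ℕ} (ha : ∀ j, monomial (a j) (1 : K) ∈ I)
    (hli : LinearIndependent ℚ fun j => extVec (a j)) (p : MvPolynomial (Fin r) K)
    (c : Fin r →₀ ℕ) :
    coeff (∑ j, c j • a j) ((aeval (fun j => reesMonomial I (a j) (ha j)) p :
      Polynomial (MvPolynomial (Fin n) K)).coeff c.degree) = coeff c p := by
  classical
  have hinj : ∀ c' : Fin r →₀ ℕ, c'.degree = c.degree → ∑ j, c' j • a j = ∑ j, c j • a j →
      c' = c := by
    intro c' hdeg hsum
    have h : ∑ j, (c' j : ℚ) • extVec (a j) = ∑ j, (c j : ℚ) • extVec (a j) := by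
      rw [extVec_sum, extVec_sum, hdeg, hsum]
    have h0 : ∑ j, ((c' j : ℚ) - c j) • extVec (a j) = 0 := by
      simp only [sub_smul, Finset.sum_sub_distrib, h, sub_self]
    ext j
    exact_mod_cast sub_eq_zero.1 (Fintype.linearIndependent_iff.1 hli _ h0 j)
  rw [coe_aeval_reesMonomial, Polynomial.finsetSum_coeff, coeff_sum]
  rw [Finset.sum_eq_single c]
  · simp
  · intro c' _ hc'
    rw [Polynomial.coeff_monomial]
    split_ifs with hdeg
    · rw [coeff_monomial, if_neg fun hsum => hc' (hinj c' hdeg hsum)]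
    · simp
  · intro hc
    simp [notMem_support_iff.1 hc]

/-- If the vectors `(a j, 1)` are linearly independent, then the classes of the elements `x^(a j) t`
in the fibre ring are algebraically independent: a nonzero polynomial in them has a coefficient of
some `t^k` with a term of degree `d * k`, while the elements of `𝔪 𝓡(I)` have no such terms. -/
theorem natCast_le_analyticSpread {I : Ideal (MvPolynomial (Fin n) K)} {d r : ℕ}
    (hI : I ≤ idealOfVars (Fin n) K ^ d) {a : Fin r → Fin n →₀ ℕ}
    (ha : ∀ j, monomial (a j) (1 : K) ∈ I) (hd : ∀ j, (a j).degree = d)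
    (hli : LinearIndependent ℚ fun j => extVec (a j)) :
    (r : WithBot ℕ∞) ≤ analyticSpread I := by
  refine natCast_le_ringKrullDim_of_injective (F := FibreRing I) ((Ideal.Quotient.mkₐ K _).comp
    (aeval fun j => reesMonomial I (a j) (ha j))) ?_
  rw [injective_iff_map_eq_zero]
  intro p hp
  ext c
  rw [← coeff_aeval_reesMonomial ha hli]
  refine (mem_pow_idealOfVars_iff' _ _).1
    (coeff_mem_pow_of_mem_map hI (Ideal.Quotient.eq_zero_iff_mem.1 hp) c.degree) _ ?_
  rw [map_sum]
  simp only [map_nsmul, hd, smul_eq_mul]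
  rw [← Finset.sum_mul, ← Finsupp.degree_eq_sum, mul_comm]
  exact Nat.lt_succ_self _

/-- The fibre ring is nonzero, because `1` is not in `𝔪 𝓡(I)`. -/
instance (I : Ideal (MvPolynomial (Fin n) K)) : Nontrivial (FibreRing I) := by
  refine Ideal.Quotient.nontrivial_iff.2 fun h => ?_
  have := coeff_mem_pow_of_mem_map (d := 0) (by simp) ((Ideal.eq_top_iff_one _).1 h) 0
  have := (C_mem_pow_idealOfVars_iff (σ := Fin n) 1 (1 : K)).1 (by simpa using this)
  simp at this

/-- A monomial ideal generated in degree `d` is generated by the monomials of degree `d` among any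
given monomial generators, and its elements have order at least `d`. -/
lemma eq_monomialIdeal_of_eq_span_homogeneous {I : Ideal (MvPolynomial (Fin n) K)}
    {A : Set (Fin n →₀ ℕ)} (hA : I = monomialIdeal K A) {d : ℕ}
    (hd : I = Ideal.span {f | f ∈ I ∧ f.IsHomogeneous d}) :
    I = monomialIdeal K {a ∈ A | a.degree = d} ∧ I ≤ idealOfVars (Fin n) K ^ d := by
  have hord : I ≤ idealOfVars (Fin n) K ^ d := by
    rw [hd, Ideal.span_le]
    rintro f ⟨-, hf⟩
    refine (mem_pow_idealOfVars_iff _ _).2 fun c hc => ?_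
    rw [Finsupp.degree_eq_weight_one]
    exact (hf (mem_support_iff.1 hc)).ge
  refine ⟨le_antisymm ?_ ?_, hord⟩
  · conv_lhs => rw [hd]
    rw [Ideal.span_le]
    rintro f ⟨hfI, hf⟩
    rw [hA, mem_ideal_span_monomial_image] at hfI
    refine mem_ideal_span_monomial_image.2 fun c hc => ?_
    obtain ⟨a, haA, hac⟩ := hfI c hc
    have haI : monomial a (1 : K) ∈ I := hA ▸ Ideal.subset_span ⟨a, haA, rfl⟩
    have h1 : d ≤ a.degree := (monomial_mem_pow_idealOfVars_iff d a one_ne_zero).1 (hord haI)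
    have h2 : c.degree = d := by
      rw [Finsupp.degree_eq_weight_one]
      exact hf (mem_support_iff.1 hc)
    have h3 : a.degree ≤ c.degree := Finsupp.degree_mono hac
    exact ⟨a, ⟨haA, by omega⟩, hac⟩
  · rw [hA]
    exact Ideal.span_mono (Set.image_mono (Set.sep_subset _ _))

end AnalyticSpread

end SquarefreeStanley

theorem corollary3p4 {K : Type*} [Field K] {n : ℕ} (I : Ideal (MvPolynomial (Fin n) K))
    (hsq : SquarefreeStanley.IsSquarefreeMonomialIdeal I)
    (hdeg : SquarefreeStanley.IsGeneratedInSingleDegree I) :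
    ∃ l : ℕ, SquarefreeStanley.analyticSpread I = (l : WithBot ℕ∞) ∧
      (I ≠ ⊥ →
        (n : ℕ∞) + 1 ≤ SquarefreeStanley.sdepth (SquarefreeStanley.idealGrading I) + (l : ℕ∞)) ∧
      (I ≠ ⊤ →
        (n : ℕ∞) ≤ SquarefreeStanley.sdepth (SquarefreeStanley.quotientGrading I) + (l : ℕ∞)) := by
  open SquarefreeStanley in
  obtain ⟨l, hl⟩ := exists_ringKrullDim_eq_natCast K (FibreRing I)
  obtain ⟨A, hA, hIA⟩ := hsq
  obtain ⟨d, hd⟩ := hdeg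
  obtain ⟨hIU, hord⟩ := eq_monomialIdeal_of_eq_span_homogeneous hIA hd
  set U : Set (Fin n →₀ ℕ) := {a ∈ A | a.degree = d}
  have hUsq : ∀ u ∈ U, ∀ i, u i ≤ 1 := fun u hu => hA u hu.1
  have hUW : ∀ u ∈ U, ∀ i ∉ (Finset.univ : Finset (Fin n)), u i = 0 := by simp
  have hrank : extRank U ≤ l := by
    obtain ⟨v, hv, -, hli⟩ := Submodule.exists_fun_fin_finrank_span_eq ℚ (extVec '' U)
    choose a haU hav using hv
    have := natCast_le_analyticSpread (a := a) hord
      (fun j => hIA ▸ Ideal.subset_span ⟨a j, (haU j).1, rfl⟩) (fun j => (haU j).2)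
      (by simpa only [hav] using hli)
    rw [analyticSpread, hl] at this
    rw [extRank]
    exact_mod_cast this
  refine ⟨l, hl, fun _ => ?_, fun _ => ?_⟩
  · have h := le_sdepth_idealGrading (K := K) (hasConePartition_multiples Finset.univ U hUsq hUW)
    rw [← hIU] at h
    refine le_trans ?_ (add_le_add_left h _)
    rw [Finset.card_univ, Fintype.card_fin]
    norm_cast
    omega
  · have h := le_sdepth_quotientGrading (K := K)
      (hasConePartition_nonmultiples Finset.univ U hUsq hUW)
    rw [← hIU] at h
    refine le_trans ?_ (add_le_add_left h _)
    rw [Finset.card_univ, Fintype.card_fin]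
    norm_cast
    omega
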